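/- Let $G=(V,E)$ be a finite directed acyclic graph, let $C$ be a finite set, and let $c\colon V\sqcup E\to C$ be a coloring of its vertices and edges with $c(V)\cap c(E)=\emptyset$; call $(G,c)$ a colored DAG. An edge $i\to j$ is written $ij$, and $\mathrm{pa}(i)$ denotes the set of parents of $i$. Let $\mathbb R^E$ be the set of matrices $\Lambda\in\mathbb R^{V\times V}$ with $\lambda_{ij}=0$ whenever $ij\notin E$, and for $\omega\in\mathbb R_{>0}^V$, $\Lambda\in\mathbb R^E$ put $$\phi_G(\omega,\Lambda)=(\mathbf 1-\Lambda)^{-T}\,\mathrm{diag}(\omega)\,(\mathbf 1-\Lambda)^{-1}.$$ The colored Gaussian DAG model $\mathcal M(G,c)$ is the set of all positive definite matrices of the form $\phi_G(\omega,\Lambda)$ with $\omega\in\mathbb R_{>0}^V$, $\Lambda\in\mathbb R^E$ such that $\omega_i=\omega_j$ whenever $c(i)=c(j)$ for $i,j\in V$, and $\lambda_{ij}=\lambda_{k\ell}$ whenever $c(ij)=c(k\ell)$ for $ij,k\ell\in E$. For a symmetric $V\times V$ matrix $\Sigma$, $i,j\in V$ and $A,K\subseteq V$, let $|\Sigma_A|$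 be the principal minor with rows and columns $A$ (equal to $1$ if $A=\emptyset$), let $|\Sigma_{ij|K}|$ be the determinant of the matrix with rows $i,K$ and columns $j,K$, the elements of $K$ being listed in the same order in the rows and in the columns, and set $$\omega_{i|A}(\Sigma)=\frac{|\Sigma_{A\cup\{i\}}|}{|\Sigma_A|},\qquad \lambda_{ij|A}(\Sigma)=\frac{|\Sigma_{ij|A\setminus\{i\}}|}{|\Sigma_A|}.$$ A set $A\subseteq V$ is *identifying* for the vertex $i$ if $\omega_{i|A}(\phi_G(\omega,\Lambda))=\omega_i$ for all $(\omega,\Lambda)\in\mathbb R^V_{>0}\times\mathbb R^E$, and *identifying* for the edge $ij\in E$ if $\lambda_{ij|A}(\phi_G(\omega,\Lambda))=\lambda_{ij}$ for all $(\omega,\Lambda)\in\mathbb R^V_{>0}\times\mathbb R^E$. A vertex $j\ne i$ is a descendant of $i$ if there is a directed path from $i$ to $j$; otherwise $j\neq i$ is a nondescendant of $i$, and $\mathrm{nd}(i)$ is the set of nondescendants of $i$. A path is a sequence of distinct vertices in which consecutive vertices are joined by an edge in either direction; a vertex $k$ of the path is a collider on it if both of its neighbors $a,b$ on the path exist and $a\to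 k$, $b\to k$ are edges. Pairwise disjoint sets $I,J$ are d-separated given $K$ (disjoint from both) if every path from a vertex of $I$ to a vertex of $J$ contains a non-collider belonging to $K$, or a collider that is not in $K$ and has no descendant in $K$. **Theorem.** Let $(G,c)$ be a colored DAG, let $\Sigma$ be a real symmetric positive definite $V\times V$ matrix, and let $X\sim \mathrm N(0,\Sigma)$. The following are equivalent: 1. $\Sigma\in\mathcal M(G,c)$. 2. (Local Markov property with respect to $(G,c)$.) For every $i\in V$, $X_i$ and $X_{\mathrm{nd}(i)\setminus\mathrm{pa}(i)}$ are conditionally independent given $X_{\mathrm{pa}(i)}$; $\omega_{i|\mathrm{pa}(i)}(\Sigma)=\omega_{j|\mathrm{pa}(j)}(\Sigma)$ for all $i,j\in V$ with $c(i)=c(j)$; and $\lambda_{ij|\mathrm{pa}(j)}(\Sigma)=\lambda_{k\ell|\mathrm{pa}(\ell)}(\Sigma)$ for all $ij,k\ell\in E$ with $c(ij)=c(k\ell)$. 3. (Global Markov property with respect to $(G,c)$.) $X_I$ and $X_J$ are conditionally independent given $X_K$ whenever $I$ and $J$ are d-separated given $K$ in $G$; $\omega_{i|A}(\Sigma)=\omega_{j|B}(\Sigma)$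 for all $i,j\in V$ with $c(i)=c(j)$, all identifying sets $A$ for $i$ and all identifying sets $B$ for $j$; and $\lambda_{ij|A}(\Sigma)=\lambda_{k\ell|B}(\Sigma)$ for all $ij,k\ell\in E$ with $c(ij)=c(k\ell)$, all identifying sets $A$ for $ij$ and all identifying sets $B$ for $k\ell$. -/

import Mathlib

open MeasureTheory ProbabilityTheory

/-! ### Directed graphs, paths and d-separation -/

namespace GaussianDAG

/-- `G` is acyclic: no vertex can be reached from itself by a nonempty directed walk. -/
def IsAcyclic {V : Type*} (G : Digraph V) : Prop :=
  ∀ v, ¬ Relation.TransGen G.Adj v v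

/-- The edges of `G`, as ordered pairs `(i, j)` with `i → j`. -/
abbrev Edge {V : Type*} (G : Digraph V) : Type _ :=
  {e : V × V // G.Adj e.1 e.2}

/-- `j` is a descendant of `i` (in an acyclic graph this excludes `j = i`). -/
def IsDescendant {V : Type*} (G : Digraph V) (i j : V) : Prop :=
  Relation.TransGen G.Adj i j

open Classical in
/-- The parents of `j`. -/
noncomputable def parents {V : Type*} [Fintype V] (G : Digraph V) (j : V) : Finset V :=
  Finset.univ.filter fun i => G.Adj i j

open Classical in
/-- The nondescendants of `i`, a set that does not contain `i` itself. -/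
noncomputable def nondescendants {V : Type*} [Fintype V] (G : Digraph V) (i : V) : Finset V :=
  Finset.univ.filter fun j => j ≠ i ∧ ¬ IsDescendant G i j

/-- A path: a sequence of distinct vertices in which consecutive vertices are adjacent, the edge
between them pointing in either direction. -/
def IsPath {V : Type*} (G : Digraph V) (p : List V) : Prop :=
  p.Nodup ∧ p.IsChain fun a b => G.Adj a b ∨ G.Adj b a

/-- `k` is a collider on the path `p`: two consecutive edges `a → k` and `b → k` of `p` meet
in `k`. -/
def IsColliderOn {V : Type*} (G : Digraph V) (p : List V) (k : V) : Prop :=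
  ∃ a b, [a, k, b] <:+: p ∧ G.Adj a k ∧ G.Adj b k

/-- The path `p` is blocked by `K`: it contains a non-collider in `K`, or a collider that is not
in `K` and has no descendant in `K`. -/
def IsBlockedBy {V : Type*} (G : Digraph V) (p : List V) (K : Finset V) : Prop :=
  ∃ k ∈ p, (¬ IsColliderOn G p k ∧ k ∈ K) ∨
    (IsColliderOn G p k ∧ k ∉ K ∧ ∀ d, IsDescendant G k d → d ∉ K)

/-- `I` and `J` are d-separated given `K`, for pairwise disjoint `I`, `J`, `K`. -/
def DSeparated {V : Type*} (G : Digraph V) (I J K : Finset V) : Prop :=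
  (Disjoint I J ∧ Disjoint I K ∧ Disjoint J K) ∧
    ∀ p : List V, IsPath G p → (∃ i ∈ I, p.head? = some i) → (∃ j ∈ J, p.getLast? = some j) →
      IsBlockedBy G p K

/-! ### The parametrization -/

/-- Positive error variances `ω` together with coefficients `Λ` supported on the edges of `G`. -/
def IsParameter {V : Type*} (G : Digraph V) (ω : V → ℝ) (Λ : Matrix V V ℝ) : Prop :=
  (∀ i, 0 < ω i) ∧ ∀ i j, ¬ G.Adj i j → Λ i j = 0

/-- The covariance matrix `(1 - Λ)⁻ᵀ diag(ω) (1 - Λ)⁻¹` of `X = Λᵀ X + ε`, `ε ~ N(0, diag(ω))`. -/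
noncomputable def covParam {V : Type*} [Fintype V] [DecidableEq V]
    (ω : V → ℝ) (Λ : Matrix V V ℝ) : Matrix V V ℝ :=
  ((1 - Λ)⁻¹).transpose * Matrix.diagonal ω * (1 - Λ)⁻¹

/-! ### Minors and the identifying rational functions -/

/-- The principal minor `|S_A|`. -/
noncomputable def principalMinor {V : Type*} [DecidableEq V]
    (S : Matrix V V ℝ) (A : Finset V) : ℝ :=
  (S.submatrix (fun a : A => (a : V)) (fun a : A => (a : V))).det

/-- The almost-principal minor `|S_{ij|K}|`: the determinant of the matrix with rows `i, K` and
columns `j, K`, where row `i` is matched with column `j`, and row `k` with column `k` for `k ∈ K`,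
so that it equals `|S_K| (S i j - S_{i,K} S_K⁻¹ S_{K,j})` if `S_K` is invertible. -/
noncomputable def almostPrincipalMinor {V : Type*} [DecidableEq V]
    (S : Matrix V V ℝ) (i j : V) (K : Finset V) : ℝ :=
  (S.submatrix (Sum.elim (fun _ : Unit => i) (fun k : K => (k : V)))
    (Sum.elim (fun _ : Unit => j) (fun k : K => (k : V)))).det

/-- `ω_{i|A}(S) = |S_{iA}| / |S_A|`. -/
noncomputable def omegaCond {V : Type*} [DecidableEq V]
    (S : Matrix V V ℝ) (i : V) (A : Finset V) : ℝ :=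
  principalMinor S (insert i A) / principalMinor S A

/-- `λ_{ij|A}(S) = |S_{ij|A∖i}| / |S_A|`. -/
noncomputable def lambdaCond {V : Type*} [DecidableEq V]
    (S : Matrix V V ℝ) (i j : V) (A : Finset V) : ℝ :=
  almostPrincipalMinor S i j (A.erase i) / principalMinor S A

/-- `A` is identifying for the vertex `i`. -/
def IsVertexIdentifying {V : Type*} [Fintype V] [DecidableEq V]
    (G : Digraph V) (i : V) (A : Finset V) : Prop :=
  ∀ (ω : V → ℝ) (Λ : Matrix V V ℝ), IsParameter G ω Λ → omegaCond (covParam ω Λ) i A = ω i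

/-- `A` is identifying for the edge `e = ij`. -/
def IsEdgeIdentifying {V : Type*} [Fintype V] [DecidableEq V]
    (G : Digraph V) (e : Edge G) (A : Finset V) : Prop :=
  ∀ (ω : V → ℝ) (Λ : Matrix V V ℝ), IsParameter G ω Λ →
    lambdaCond (covParam ω Λ) e.1.1 e.1.2 A = Λ e.1.1 e.1.2

/-! ### Conditional independence and the Markov properties of a DAG -/

/-- The subvector `x_A` of `x`. -/
def subvector {V : Type*} (A : Finset V) (x : EuclideanSpace ℝ V) : A → ℝ :=
  fun a => x a

theorem measurable_subvector {V : Type*} [Fintype V] (A : Finset V) :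
    Measurable (subvector (V := V) A) := by
  unfold subvector
  fun_prop

/-- For `X ~ N(0, S)`, the subvectors `X_I` and `X_J` are conditionally independent given `X_K`. -/
def GaussianCI {V : Type*} [Fintype V] [DecidableEq V]
    (S : Matrix V V ℝ) (I J K : Finset V) : Prop :=
  CondIndepFun (MeasurableSpace.comap (subvector K) inferInstance)
    (measurable_subvector K).comap_le (subvector I) (subvector J)
    (multivariateGaussian (0 : EuclideanSpace ℝ V) S)

/-- The local Markov property with respect to `G`. -/
def LocalMarkov {V : Type*} [Fintype V] [DecidableEq V]
    (G : Digraph V) (S : Matrix V V ℝ) : Prop :=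
  ∀ i, GaussianCI S {i} (nondescendants G i \ parents G i) (parents G i)

/-- The global Markov property with respect to `G`. -/
def GlobalMarkov {V : Type*} [Fintype V] [DecidableEq V]
    (G : Digraph V) (S : Matrix V V ℝ) : Prop :=
  ∀ I J K : Finset V, DSeparated G I J K → GaussianCI S I J K

end GaussianDAG

/-! ### Colored DAGs -/

open GaussianDAG

/-- A colored DAG: an acyclic directed graph on `V` with a coloring of its vertices and edges by
elements of `C`, such that no vertex has the same color as an edge. -/
structure ColoredDAG (V C : Type*) where
  graph : Digraph V
  acyclic : IsAcyclic graph
  color : V ⊕ Edge graph → C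
  color_ne : ∀ (i : V) (e : Edge graph), color (Sum.inl i) ≠ color (Sum.inr e)

namespace ColoredDAG

/-- The colored parameter space: parameters of the DAG model that agree on vertices of the same
color and on edges of the same color. -/
def IsColoredParameter {V C : Type*} (D : ColoredDAG V C) (ω : V → ℝ) (Λ : Matrix V V ℝ) : Prop :=
  IsParameter D.graph ω Λ ∧
    (∀ i j : V, D.color (Sum.inl i) = D.color (Sum.inl j) → ω i = ω j) ∧
    (∀ e f : Edge D.graph, D.color (Sum.inr e) = D.color (Sum.inr f) →
      Λ e.1.1 e.1.2 = Λ f.1.1 f.1.2)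

/-- The colored Gaussian DAG model, as a set of covariance matrices. -/
def model {V C : Type*} [Fintype V] [DecidableEq V] (D : ColoredDAG V C) :
    Set (Matrix V V ℝ) :=
  {S | S.PosDef ∧ ∃ (ω : V → ℝ) (Λ : Matrix V V ℝ), D.IsColoredParameter ω Λ ∧ S = covParam ω Λ}

/-- `S` satisfies the vertex-coloring constraint `vcc(i, j; A, B)`. -/
def VCC {V : Type*} [DecidableEq V] (S : Matrix V V ℝ) (i j : V) (A B : Finset V) : Prop :=
  omegaCond S i A - omegaCond S j B = 0

/-- `S` satisfies the edge-coloring constraint `ecc(ij, kl; A, B)`. -/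
def ECC {V : Type*} [DecidableEq V] (S : Matrix V V ℝ) (i j k l : V) (A B : Finset V) : Prop :=
  lambdaCond S i j A - lambdaCond S k l B = 0

/-- The local Markov property with respect to a colored DAG. -/
def LocalColoredMarkov {V C : Type*} [Fintype V] [DecidableEq V]
    (D : ColoredDAG V C) (S : Matrix V V ℝ) : Prop :=
  LocalMarkov D.graph S ∧
    (∀ i j : V, D.color (Sum.inl i) = D.color (Sum.inl j) →
      VCC S i j (parents D.graph i) (parents D.graph j)) ∧
    (∀ e f : Edge D.graph, D.color (Sum.inr e) = D.color (Sum.inr f) →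
      ECC S e.1.1 e.1.2 f.1.1 f.1.2 (parents D.graph e.1.2) (parents D.graph f.1.2))

/-- The global Markov property with respect to a colored DAG. -/
def GlobalColoredMarkov {V C : Type*} [Fintype V] [DecidableEq V]
    (D : ColoredDAG V C) (S : Matrix V V ℝ) : Prop :=
  GlobalMarkov D.graph S ∧
    (∀ i j : V, D.color (Sum.inl i) = D.color (Sum.inl j) →
      ∀ A B : Finset V, IsVertexIdentifying D.graph i A → IsVertexIdentifying D.graph j B →
        VCC S i j A B) ∧
    (∀ e f : Edge D.graph, D.color (Sum.inr e) = D.color (Sum.inr f) →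
      ∀ A B : Finset V, IsEdgeIdentifying D.graph e A → IsEdgeIdentifying D.graph f B →
        ECC S e.1.1 e.1.2 f.1.1 f.1.2 A B)

end ColoredDAG

/-!
The theorem says that the parametrization of the model can be read off from `S`, and that this is
possible exactly if `S` has the independences of the graph; the colors come along for free.

Conditional independence is first turned into linear algebra. Call `r` a regression of `x` on `K`
if it is supported on `K` and the residual `x - r`, a vector of coefficients, is uncorrelated with
`X k` for `k ∈ K`. For positive definite `S` it exists and is unique. If the residual of `X i` on
`X_K` is uncorrelated with `X j` for all `i ∈ I`, `j ∈ J`, then the vector of residuals is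
independent of `(X_K, X_J)`, so that `X_I`, a function of `X_K` and of the residuals, is
conditionally independent of `X_J` given `X_K` (`gaussianCI_of_partialUncorrelated`). Conversely,
under conditional independence `X j` does not improve the prediction of `X i` from `X_K`, so that
the residual is uncorrelated with `X j` (`partialUncorrelated_of_gaussianCI`). Moreover
`omegaCond` is a residual variance and `lambdaCond` a regression coefficient, by column operations
on the minors.

From the local Markov property to the model: regress every variable on its parents. The residuals
are uncorrelated with the nondescendants, hence with each other, and this says that `S` is of the
form `covParam ω Λ` with `Λ` the matrix of regression coefficients (`eq_covParam_of_localMarkov`).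
In the model, the same computation shows that the parents are identifying, both for a vertex and
for the edges into it, so that the local coloring constraints say that `ω` and `Λ` respect the
colors.

From the model to the global Markov property: by the definition of identifying sets, the coloring
constraints are the equalities between the parameters. The independences follow by induction on an
ancestral set of vertices (`partialUncorrelated_covParam`), removing a sink `s`. If `s` is one of
the two separated vertices, its structural equation replaces it by its parents, and active paths
from the parents prolong to active paths from `s`. If `s` is in the conditioning set, then one of
the two vertices is separated from `s` by the rest of that set, as otherwise two active paths that
meet in `s` would combine to one between the two vertices (`IsActivePath.join`).

The global property contains the local one, as the parents of a vertex d-separate it from its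
other nondescendants (`dSeparated_parents`) and are identifying.
-/

/-! ### Conditional independence through residuals -/

namespace ProbabilityTheory

/-- If `ε` is independent of `T`, then the conditional law of `F (T, ε)` given `T` is the law of
`F (t, ε)` with `t` frozen. -/
theorem condDistrib_of_indepFun {Ω α β γ : Type*} [MeasurableSpace Ω] [MeasurableSpace α]
    [MeasurableSpace β] [StandardBorelSpace β] [Nonempty β] [MeasurableSpace γ]
    {μ : Measure Ω} [IsProbabilityMeasure μ] {T : Ω → α} {ε : Ω → γ} {F : α × γ → β}
    (hT : Measurable T) (hε : Measurable ε) (hF : Measurable F) (h : IndepFun T ε μ) :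
    condDistrib (fun ω => F (T ω, ε ω)) T μ =ᵐ[μ.map T]
      (Kernel.id ×ₖ Kernel.const α (μ.map ε)).map F := by
  have : IsProbabilityMeasure (μ.map ε) := Measure.isProbabilityMeasure_map hε.aemeasurable
  have : IsProbabilityMeasure (μ.map T) := Measure.isProbabilityMeasure_map hT.aemeasurable
  refine condDistrib_ae_eq_of_measure_eq_compProd_of_measurable hT (by fun_prop) ?_
  have h1 : μ.map (fun ω => (T ω, F (T ω, ε ω))) =
      ((μ.map T).prod (μ.map ε)).map (fun p => (p.1, F p)) := by
    rw [← (indepFun_iff_map_prod_eq_prod_map_map hT.aemeasurable hε.aemeasurable).1 h,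
      Measure.map_map (by fun_prop) (by fun_prop)]
    rfl
  rw [h1]
  ext s hs
  rw [Measure.map_apply (by fun_prop) hs, Measure.prod_apply (hs.preimage (by fun_prop)),
    Measure.compProd_apply hs]
  refine lintegral_congr fun t => ?_
  rw [Kernel.map_apply' _ hF _ (hs.preimage (by fun_prop)), Kernel.prod_apply, Kernel.id_apply,
    Kernel.const_apply, Measure.dirac_prod, Measure.map_apply (by fun_prop)
      (hF (hs.preimage (by fun_prop)))]
  rfl

/-- If `ε` is independent of `(k, g)`, then `F (k, ε)` and `g` are conditionally independent
given `k`. -/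
theorem condIndepFun_of_indepFun_prodMk {Ω α β β' γ : Type*} [MeasurableSpace Ω]
    [StandardBorelSpace Ω] [MeasurableSpace α]
    [MeasurableSpace β] [StandardBorelSpace β] [Nonempty β] [MeasurableSpace β']
    [StandardBorelSpace β'] [Nonempty β'] [MeasurableSpace γ]
    {μ : Measure Ω} [IsProbabilityMeasure μ] {k : Ω → α} {g : Ω → β'} {ε : Ω → γ} {F : α × γ → β}
    (hk : Measurable k) (hg : Measurable g) (hε : Measurable ε) (hF : Measurable F)
    (h : IndepFun (fun ω => (k ω, g ω)) ε μ) :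
    CondIndepFun (MeasurableSpace.comap k inferInstance) hk.comap_le
      (fun ω => F (k ω, ε ω)) g μ := by
  refine CondIndepFun.symm ?_
  rw [condIndepFun_iff_condDistrib_prod_ae_eq_prodMkRight (by fun_prop) hg hk]
  have h1 := condDistrib_of_indepFun (T := fun ω => (k ω, g ω))
    (F := fun p : (α × β') × γ => F (p.1.1, p.2))
    (by fun_prop) hε (by fun_prop) h
  have h2 := condDistrib_of_indepFun hk hε hF (h.comp measurable_fst measurable_id)
  have hmap : μ.map k = (μ.map (fun ω => (k ω, g ω))).map Prod.fst := by
    rw [Measure.map_map (by fun_prop) (by fun_prop)]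
    rfl
  rw [hmap] at h2
  have h3 := ae_of_ae_map measurable_fst.aemeasurable h2
  have : IsProbabilityMeasure (μ.map ε) := Measure.isProbabilityMeasure_map hε.aemeasurable
  filter_upwards [h1, h3] with p hp1 hp3
  rw [hp1, Kernel.prodMkRight_apply, hp3, Kernel.map_apply _ (by fun_prop),
    Kernel.map_apply _ hF, Kernel.prod_apply, Kernel.prod_apply, Kernel.id_apply, Kernel.id_apply,
    Kernel.const_apply, Kernel.const_apply, Measure.dirac_prod, Measure.dirac_prod,
    Measure.map_map (μ := μ.map ε) (by fun_prop) (by fun_prop),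
    Measure.map_map (μ := μ.map ε) (by fun_prop) (by fun_prop)]
  rfl

/-- If `Y` and `g` are conditionally independent given `k`, then `g` does not help to predict `Y`
from `k`. -/
theorem CondIndepFun.condExp_prodMk_ae_eq {Ω α β : Type*} [MeasurableSpace Ω]
    [StandardBorelSpace Ω] [MeasurableSpace α] [MeasurableSpace β] [StandardBorelSpace β]
    [Nonempty β] {μ : Measure Ω} [IsProbabilityMeasure μ] {k : Ω → α} {g : Ω → β} {Y : Ω → ℝ}
    (hk : Measurable k) (hg : Measurable g) (hY : Measurable Y) (hYi : Integrable Y μ)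
    (h : CondIndepFun (MeasurableSpace.comap k inferInstance) hk.comap_le Y g μ) :
    μ[Y | MeasurableSpace.comap (fun ω => (k ω, g ω)) inferInstance] =ᵐ[μ]
      μ[Y | MeasurableSpace.comap k inferInstance] := by
  have h1 := (condIndepFun_iff_condDistrib_prod_ae_eq_prodMkRight hY hg hk).1 h.symm
  have h2 := ae_of_ae_map (by fun_prop) h1
  filter_upwards [condExp_ae_eq_integral_condDistrib' (hk.prodMk hg) hYi,
    condExp_ae_eq_integral_condDistrib' hk hYi, h2] with ω a1 a2 a3
  rw [a1, a2, a3, Kernel.prodMkRight_apply]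

/-- If a residual `Y - H` has constant conditional expectation given `m₁`, where `H` is
`m₁`-measurable, and if the larger σ-algebra `m₂` does not improve the prediction of `Y`, then the
residual is uncorrelated with every `m₂`-measurable variable. -/
theorem covariance_sub_eq_zero_of_condExp_eq {Ω : Type*} {m₁ m₂ mΩ : MeasurableSpace Ω}
    {μ : Measure Ω} [IsProbabilityMeasure μ] {Y Z H : Ω → ℝ} (h12 : m₁ ≤ m₂) (h2 : m₂ ≤ mΩ)
    (hY : MemLp Y 2 μ) (hZ : MemLp Z 2 μ) (hH : MemLp H 2 μ)
    (hHm : StronglyMeasurable[m₁] H) (hZm : StronglyMeasurable[m₂] Z)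
    (hYm : μ[Y | m₂] =ᵐ[μ] μ[Y | m₁]) {c : ℝ} (hc : μ[Y - H | m₁] =ᵐ[μ] fun _ => c) :
    cov[Y - H, Z; μ] = 0 := by
  have hYi : Integrable Y μ := hY.integrable (by norm_num)
  have hHi : Integrable H μ := hH.integrable (by norm_num)
  have hc2 : μ[Y - H | m₂] =ᵐ[μ] fun _ => c := by
    have a1 := condExp_sub hYi hHi m₁
    have a2 := condExp_sub hYi hHi m₂
    rw [condExp_of_stronglyMeasurable (h12.trans h2) hHm hHi] at a1
    rw [condExp_of_stronglyMeasurable h2 (hHm.mono h12) hHi] at a2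
    filter_upwards [a1, a2, hYm, hc] with x b1 b2 b3 b4
    rw [b2, ← b4, b1, Pi.sub_apply, Pi.sub_apply, b3]
  have hmean : μ[Y - H] = c := by
    rw [← integral_condExp (h12.trans h2), integral_congr_ae hc]
    simp
  have hprod : μ[(Y - H) * Z] = c * μ[Z] := by
    have hi : Integrable ((Y - H) * Z) μ := (hY.sub hH).integrable_mul hZ
    rw [← integral_condExp h2, integral_congr_ae
      (condExp_mul_of_stronglyMeasurable_right hZm hi (hYi.sub hHi)), ← integral_const_mul]
    refine integral_congr_ae ?_
    filter_upwards [hc2] with x hx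
    simp [hx]
  rw [covariance_eq_sub (hY.sub hH) hZ, hprod, hmean, sub_self]

/-- If `Y` and `Z` are conditionally independent given `k`, and `H` is a predictor of `Y` from `k`
whose residual is independent of `k`, then the residual is uncorrelated with `Z`. -/
theorem CondIndepFun.covariance_sub_eq_zero {Ω α : Type*} [MeasurableSpace Ω]
    [StandardBorelSpace Ω] [MeasurableSpace α] {μ : Measure Ω} [IsProbabilityMeasure μ]
    {k : Ω → α} {Y Z H : Ω → ℝ} (hk : Measurable k)
    (h : CondIndepFun (MeasurableSpace.comap k inferInstance) hk.comap_le Y Z μ)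
    (hYm : Measurable Y) (hZm : Measurable Z)
    (hY : MemLp Y 2 μ) (hZ : MemLp Z 2 μ) (hH : MemLp H 2 μ)
    (hHm : Measurable[MeasurableSpace.comap k inferInstance] H)
    (hind : IndepFun (Y - H) k μ) : cov[Y - H, Z; μ] = 0 := by
  have hHm' : Measurable H := hHm.mono hk.comap_le le_rfl
  refine covariance_sub_eq_zero_of_condExp_eq (Z := Z) ?_ (hk.prodMk hZm).comap_le hY hZ hH
    hHm.stronglyMeasurable ?_
    (h.condExp_prodMk_ae_eq hk hZm hYm (hY.integrable (by norm_num)))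
    (condExp_indep_eq (hYm.sub hHm').comap_le hk.comap_le
      (comap_measurable (Y - H)).stronglyMeasurable hind)
  · exact (measurable_fst.comp (comap_measurable fun ω => (k ω, Z ω))).comap_le
  · exact (measurable_snd.comp (comap_measurable fun ω => (k ω, Z ω))).stronglyMeasurable

end ProbabilityTheory

/-! ### Conditional independence in Gaussian vectors -/

namespace GaussianDAG

/-- `r` is the coefficient vector of the best linear predictor of `∑ v, x v * X v` from the
variables `X k`, `k ∈ K`, when `X` has covariance matrix `S`: it is supported on `K`, and the
residual `x - r` is uncorrelated with these variables. -/
def IsRegression {V : Type*} [Fintype V] (S : Matrix V V ℝ) (K : Finset V) (x r : V → ℝ) : Prop :=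
  (∀ v, v ∉ K → r v = 0) ∧ ∀ k ∈ K, Matrix.vecMul (x - r) S k = 0

/-- The residual of `∑ v, x v * X v` on the variables `X k`, `k ∈ K`, is uncorrelated with `X j`,
i.e. the partial covariance given `K` vanishes. -/
def PartialUncorrelated {V : Type*} [Fintype V] (S : Matrix V V ℝ) (K : Finset V) (x : V → ℝ)
    (j : V) : Prop :=
  ∃ r, IsRegression S K x r ∧ Matrix.vecMul (x - r) S j = 0

/-- The linear functional with coefficient vector `a`. -/
noncomputable def linearCombo {V : Type*} [Fintype V] (a : V → ℝ) (x : EuclideanSpace ℝ V) : ℝ :=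
  ∑ v, a v * x v

theorem measurable_linearCombo {V : Type*} [Fintype V] (a : V → ℝ) :
    Measurable (linearCombo a) := by
  unfold linearCombo
  fun_prop

theorem linearCombo_single {V : Type*} [Fintype V] [DecidableEq V] (i : V)
    (x : EuclideanSpace ℝ V) : linearCombo (Pi.single i 1) x = x i := by
  simp [linearCombo, Pi.single_apply]

theorem linearCombo_sub {V : Type*} [Fintype V] (a b : V → ℝ)
    (x : EuclideanSpace ℝ V) : linearCombo (a - b) x = linearCombo a x - linearCombo b x := by
  simp [linearCombo, sub_mul]

theorem linearCombo_of_support {V : Type*} [Fintype V] {K : Finset V} {r : V → ℝ}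
    (hr : ∀ v, v ∉ K → r v = 0) (x : EuclideanSpace ℝ V) :
    linearCombo r x = ∑ k : K, r k * subvector K x k := by
  have h1 : linearCombo r x = ∑ k ∈ K, r k * x k :=
    (Finset.sum_subset (Finset.subset_univ K) fun v _ hv => by simp [hr v hv]).symm
  rw [h1, ← Finset.sum_coe_sort]
  rfl

section Gaussian

variable {V : Type*} [Fintype V] [DecidableEq V] {S : Matrix V V ℝ}

theorem covariance_linearCombo (hS : S.PosSemidef) (a b : V → ℝ) :
    cov[linearCombo a, linearCombo b; multivariateGaussian (0 : EuclideanSpace ℝ V) S] =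
      Matrix.vecMul a S ⬝ᵥ b := by
  have h1 : ∀ a : V → ℝ, linearCombo a = fun u => inner ℝ (WithLp.toLp 2 a) u := by
    intro a
    ext u
    simp [linearCombo, PiLp.inner_apply, mul_comm]
  rw [h1, h1, ← covarianceBilin_apply_eq_cov IsGaussian.memLp_two_id,
    covarianceBilin_multivariateGaussian hS]
  simp [Matrix.dotProduct_mulVec]

theorem hasGaussianLaw_linearCombo {ι : Type*} [Finite ι] (a : ι → V → ℝ) :
    HasGaussianLaw (fun x i => linearCombo (a i) x)
      (multivariateGaussian (0 : EuclideanSpace ℝ V) S) := by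
  have : Fintype ι := Fintype.ofFinite ι
  let L : EuclideanSpace ℝ V →ₗ[ℝ] (ι → ℝ) :=
    { toFun := fun x i => linearCombo (a i) x
      map_add' := fun x y => by
        ext i; simp [linearCombo, mul_add, Finset.sum_add_distrib]
      map_smul' := fun c x => by
        ext i; simp [linearCombo, Finset.mul_sum, mul_left_comm] }
  exact (IsGaussian.hasGaussianLaw_id).map_fun L.toContinuousLinearMap

theorem indepFun_linearCombo {ι κ : Type*} [Finite ι] [Finite κ] (hS : S.PosSemidef)
    (a : ι → V → ℝ) (b : κ → V → ℝ) (h : ∀ i j, Matrix.vecMul (a i) S ⬝ᵥ b j = 0) :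
    IndepFun (fun x i => linearCombo (a i) x) (fun x j => linearCombo (b j) x)
      (multivariateGaussian (0 : EuclideanSpace ℝ V) S) := by
  have : Fintype ι := Fintype.ofFinite ι
  have : Fintype κ := Fintype.ofFinite κ
  have hlaw := (hasGaussianLaw_linearCombo (S := S) (Sum.elim a b))
  let L : (ι ⊕ κ → ℝ) →ₗ[ℝ] ((ι → ℝ) × (κ → ℝ)) :=
    { toFun := fun x => (fun i => x (Sum.inl i), fun j => x (Sum.inr j))
      map_add' := fun x y => rfl
      map_smul' := fun c x => rfl }
  refine HasGaussianLaw.indepFun_of_covariance_eval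
    (X := fun i x => linearCombo (a i) x) (Y := fun j x => linearCombo (b j) x)
    (hlaw.map_fun L.toContinuousLinearMap) fun i j => ?_
  rw [covariance_linearCombo hS, h]

theorem isRegression_unique (hS : S.PosDef) {K : Finset V} {x r r' : V → ℝ}
    (h : IsRegression S K x r) (h' : IsRegression S K x r') : r = r' := by
  have hd : ∀ k ∈ K, Matrix.vecMul (r - r') S k = 0 := by
    intro k hk
    have h1 := h.2 k hk
    have h2 := h'.2 k hk
    simp only [Matrix.sub_vecMul, Pi.sub_apply] at *
    linarith
  have h0 : Matrix.vecMul (r - r') S ⬝ᵥ (r - r') = 0 := by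
    refine Finset.sum_eq_zero fun v _ => ?_
    by_cases hv : v ∈ K
    · simp [hd v hv]
    · simp [h.1 v hv, h'.1 v hv]
  by_contra hne
  have := hS.dotProduct_mulVec_pos (sub_ne_zero.2 hne)
  rw [Matrix.dotProduct_mulVec] at this
  simp only [star_trivial] at this
  linarith

theorem exists_isRegression (hS : S.PosDef) (K : Finset V) (x : V → ℝ) :
    ∃ r, IsRegression S K x r := by
  let A : Matrix K K ℝ := S.submatrix (fun k => (k : V)) (fun k => (k : V))
  have hA : IsUnit A.det :=
    (hS.submatrix Subtype.val_injective).det_pos.ne'.isUnit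
  let y : K → ℝ := fun k => Matrix.vecMul x S k
  let s : K → ℝ := Matrix.vecMul y A⁻¹
  have hs : Matrix.vecMul s A = y := by
    simp [s, Matrix.vecMul_vecMul, Matrix.nonsing_inv_mul A hA]
  let r : V → ℝ := fun v => if h : v ∈ K then s ⟨v, h⟩ else 0
  refine ⟨r, fun v hv => dif_neg hv, fun k hk => ?_⟩
  have h1 : Matrix.vecMul r S k = Matrix.vecMul s A ⟨k, hk⟩ := by
    simp only [Matrix.vecMul, dotProduct]
    rw [← Finset.sum_subset (Finset.subset_univ K) fun v _ hv => by simp [r, hv],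
      ← Finset.sum_coe_sort K]
    refine Finset.sum_congr rfl fun v _ => ?_
    simp [r, A]
  rw [Matrix.sub_vecMul, Pi.sub_apply, h1, hs, sub_self]

/-- Vanishing partial covariances imply conditional independence: the vector of residuals of `X_I`
on `X_K` is independent of `(X_K, X_J)`. -/
theorem gaussianCI_of_partialUncorrelated (hS : S.PosDef) {I J K : Finset V}
    (h : ∀ i ∈ I, ∀ j ∈ J, PartialUncorrelated S K (Pi.single i 1) j) :
    GaussianCI S I J K := by
  choose r hr using fun i : V => exists_isRegression hS K (Pi.single i 1)
  have hJ : ∀ i ∈ I, ∀ j ∈ J, Matrix.vecMul (Pi.single i 1 - r i) S j = 0 := by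
    intro i hi j hj
    obtain ⟨r', hr', h0⟩ := h i hi j hj
    rwa [isRegression_unique hS (hr i) hr']
  have hind := indepFun_linearCombo (ι := K ⊕ J) (κ := I) hS.posSemidef
    (Sum.elim (fun k => Pi.single (k : V) 1) (fun j => Pi.single (j : V) 1))
    (fun i => Pi.single (i : V) 1 - r i) (by
      have hsymm : ∀ (a : V → ℝ) (v : V), Matrix.vecMul (Pi.single v 1) S ⬝ᵥ a =
          Matrix.vecMul a S v := by
        intro a v
        have hT : S.transpose = S := by simpa using hS.isHermitian.eq
        rw [← Matrix.dotProduct_mulVec, single_one_dotProduct, ← Matrix.vecMul_transpose, hT]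
      rintro (k | j) i
      · exact (hsymm _ _).trans ((hr i).2 k k.2)
      · exact (hsymm _ _).trans (hJ i i.2 j j.2))
  have hF : Measurable fun p : (K → ℝ) × (I → ℝ) =>
      fun i : I => (∑ k : K, r i k * p.1 k) + p.2 i := by
    fun_prop
  have hCI := condIndepFun_of_indepFun_prodMk
    (μ := multivariateGaussian (0 : EuclideanSpace ℝ V) S)
    (k := subvector K) (g := subvector J)
    (ε := fun x (i : I) => linearCombo (Pi.single (i : V) 1 - r i) x)
    (measurable_subvector K) (measurable_subvector J)
    (measurable_pi_lambda _ fun i => measurable_linearCombo _) hF (by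
      have := hind.comp (φ := fun y : K ⊕ J → ℝ => (fun k => y (Sum.inl k), fun j => y (Sum.inr j)))
        (ψ := id) (by fun_prop) measurable_id
      convert this using 1
      ext x <;> simp [subvector, linearCombo_single]
      rfl)
  unfold GaussianCI
  convert hCI using 1
  ext x i
  change x i = ∑ k : K, r i k * subvector K x k + linearCombo (Pi.single (i : V) 1 - r i) x
  rw [linearCombo_sub, ← linearCombo_of_support (hr i).1, linearCombo_single]
  ring

/-- Conditional independence forces the partial covariances to vanish. -/
theorem partialUncorrelated_of_gaussianCI (hS : S.PosDef) {I J K : Finset V}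
    (hCI : GaussianCI S I J K) {i j : V} (hi : i ∈ I) (hj : j ∈ J) :
    PartialUncorrelated S K (Pi.single i 1) j := by
  obtain ⟨r, hr⟩ := exists_isRegression hS K (Pi.single i 1)
  refine ⟨r, hr, ?_⟩
  have hL2 : ∀ a : V → ℝ, MemLp (linearCombo a) 2
      (multivariateGaussian (0 : EuclideanSpace ℝ V) S) := fun a =>
    ((hasGaussianLaw_linearCombo (S := S) (fun _ : Unit => a)).eval ()).memLp_two
  have hsingle : ∀ v : V, linearCombo (Pi.single v 1) = fun x : EuclideanSpace ℝ V => x v :=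
    fun v => funext (linearCombo_single v)
  have hCI' : CondIndepFun (MeasurableSpace.comap (subvector K) inferInstance)
      (measurable_subvector K).comap_le (linearCombo (Pi.single i 1)) (linearCombo (Pi.single j 1))
      (multivariateGaussian (0 : EuclideanSpace ℝ V) S) := by
    rw [hsingle, hsingle]
    exact CondIndepFun.comp hCI (measurable_pi_apply (⟨i, hi⟩ : I))
      (measurable_pi_apply (⟨j, hj⟩ : J))
  have hind := indepFun_linearCombo (ι := Unit) (κ := K) hS.posSemidef
    (fun _ => Pi.single i 1 - r) (fun k => Pi.single (k : V) 1)
    (fun _ k => by simpa using hr.2 k k.2)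
  have hsub : linearCombo (Pi.single i 1) - linearCombo r = linearCombo (Pi.single i 1 - r) :=
    (funext (linearCombo_sub _ _)).symm
  have hcov := hCI'.covariance_sub_eq_zero (H := linearCombo r) (measurable_subvector K)
    (measurable_linearCombo _) (measurable_linearCombo _) (hL2 _) (hL2 _) (hL2 _) (by
      have : linearCombo r = (fun y : K → ℝ => ∑ k : K, r k * y k) ∘ subvector K :=
        funext (linearCombo_of_support hr.1)
      rw [this]
      exact Measurable.comp (by fun_prop) (comap_measurable (subvector K))) (by
      rw [hsub]
      have := hind.comp (φ := fun y : Unit → ℝ => y ()) (ψ := id)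
        (measurable_pi_apply (X := fun _ : Unit => ℝ) ()) measurable_id
      convert this using 1
      · ext x
        rfl
      · ext x k
        simp [subvector, linearCombo_single])
  rw [hsub, covariance_linearCombo hS.posSemidef] at hcov
  rwa [dotProduct_single_one] at hcov

end Gaussian

/-! ### Partial covariances and minors -/

section LinearAlgebra

variable {V : Type*} {S : Matrix V V ℝ}

theorem isSymm_of_posDef (hS : S.PosDef) : S.IsSymm := by
  simpa [Matrix.IsSymm] using hS.isHermitian.eq

theorem principalMinor_pos [DecidableEq V] (hS : S.PosDef) (A : Finset V) :
    0 < principalMinor S A :=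
  (hS.submatrix Subtype.val_injective).det_pos

theorem principalMinor_insert [DecidableEq V] {i : V} {K : Finset V} (hi : i ∉ K) :
    principalMinor S (insert i K) = almostPrincipalMinor S i i K := by
  let f : Unit ⊕ K → (insert i K : Finset V) :=
    Sum.elim (fun _ => ⟨i, Finset.mem_insert_self i K⟩)
      (fun k => ⟨k, Finset.mem_insert_of_mem k.2⟩)
  have hf : Function.Bijective f := by
    constructor
    · rintro (a | a) (b | b) h
      · rfl
      · exact absurd (congrArg Subtype.val h) fun h : i = b => hi (h ▸ b.2)
      · exact absurd (congrArg Subtype.val h) fun h : (a : V) = i => hi (h ▸ a.2)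
      · exact congrArg Sum.inr (Subtype.ext (congrArg Subtype.val h :))
    · rintro ⟨v, hv⟩
      rcases Finset.mem_insert.1 hv with rfl | hv'
      · exact ⟨Sum.inl (), rfl⟩
      · exact ⟨Sum.inr ⟨v, hv'⟩, rfl⟩
  rw [principalMinor, almostPrincipalMinor,
    ← Matrix.det_submatrix_equiv_self (Equiv.ofBijective f hf)]
  congr 1
  ext (a | a) (b | b) <;> rfl

variable [Fintype V]

theorem vecMul_dotProduct_comm (hS : S.IsSymm) (a b : V → ℝ) :
    Matrix.vecMul a S ⬝ᵥ b = Matrix.vecMul b S ⬝ᵥ a := by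
  rw [← Matrix.dotProduct_mulVec, ← Matrix.vecMul_transpose, hS.eq, dotProduct_comm]

theorem IsRegression.add {K : Finset V} {x y r s : V → ℝ} (hx : IsRegression S K x r)
    (hy : IsRegression S K y s) : IsRegression S K (x + y) (r + s) := by
  refine ⟨fun v hv => by simp [hx.1 v hv, hy.1 v hv], fun k hk => ?_⟩
  rw [add_sub_add_comm, Matrix.add_vecMul, Pi.add_apply, hx.2 k hk, hy.2 k hk, add_zero]

theorem IsRegression.smul {K : Finset V} {x r : V → ℝ} (hx : IsRegression S K x r) (c : ℝ) :
    IsRegression S K (c • x) (c • r) := by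
  refine ⟨fun v hv => by simp [hx.1 v hv], fun k hk => ?_⟩
  rw [← smul_sub, Matrix.smul_vecMul, Pi.smul_apply, hx.2 k hk, smul_zero]

theorem PartialUncorrelated.zero (K : Finset V) (j : V) : PartialUncorrelated S K 0 j :=
  ⟨0, ⟨fun _ _ => rfl, fun k _ => by simp⟩, by simp⟩

theorem PartialUncorrelated.add {K : Finset V} {x y : V → ℝ} {j : V}
    (hx : PartialUncorrelated S K x j) (hy : PartialUncorrelated S K y j) :
    PartialUncorrelated S K (x + y) j := by
  obtain ⟨r, hr, hr0⟩ := hx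
  obtain ⟨s, hs, hs0⟩ := hy
  refine ⟨r + s, hr.add hs, ?_⟩
  rw [add_sub_add_comm, Matrix.add_vecMul, Pi.add_apply, hr0, hs0, add_zero]

theorem PartialUncorrelated.smul {K : Finset V} {x : V → ℝ} {j : V}
    (hx : PartialUncorrelated S K x j) (c : ℝ) :
    PartialUncorrelated S K (c • x) j := by
  obtain ⟨r, hr, hr0⟩ := hx
  refine ⟨c • r, hr.smul c, ?_⟩
  rw [← smul_sub, Matrix.smul_vecMul, Pi.smul_apply, hr0, smul_zero]

theorem PartialUncorrelated.sum {ι : Type*} {K : Finset V} {j : V} (s : Finset ι)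
    {x : ι → V → ℝ} (h : ∀ i ∈ s, PartialUncorrelated S K (x i) j) :
    PartialUncorrelated S K (∑ i ∈ s, x i) j :=
  Finset.sum_induction x (fun y => PartialUncorrelated S K y j)
    (fun _ _ => PartialUncorrelated.add) (PartialUncorrelated.zero K j) h

/-- Residuals on `K` are uncorrelated with combinations of the variables in `K`. -/
theorem IsRegression.vecMul_dotProduct_eq_zero {K : Finset V} {x r s : V → ℝ}
    (h : IsRegression S K x r) (hs : ∀ v, v ∉ K → s v = 0) :
    Matrix.vecMul (x - r) S ⬝ᵥ s = 0 := by
  refine Finset.sum_eq_zero fun v _ => ?_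
  by_cases hv : v ∈ K
  · simp [h.2 v hv]
  · simp [hs v hv]

variable [DecidableEq V]

theorem partialUncorrelated_single_of_mem {K : Finset V} {k : V} (hk : k ∈ K) (j : V) :
    PartialUncorrelated S K (Pi.single k 1) j := by
  refine ⟨Pi.single k 1, ⟨fun v hv => ?_, fun l _ => ?_⟩, ?_⟩
  · exact Pi.single_eq_of_ne (fun h : v = k => hv (h ▸ hk)) _
  all_goals simp

theorem PartialUncorrelated.symm (hS : S.PosDef) {K : Finset V} {i j : V}
    (h : PartialUncorrelated S K (Pi.single i 1) j) :
    PartialUncorrelated S K (Pi.single j 1) i := by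
  obtain ⟨r, hr, h0⟩ := h
  obtain ⟨s, hs⟩ := exists_isRegression hS K (Pi.single j 1)
  refine ⟨s, hs, ?_⟩
  -- The covariance of the two residuals is symmetric, and in it either residual may be replaced by
  -- the variable itself.
  have h1 := hr.vecMul_dotProduct_eq_zero hs.1
  have h2 := hs.vecMul_dotProduct_eq_zero hr.1
  have h3 := vecMul_dotProduct_comm (isSymm_of_posDef hS) (Pi.single i 1 - r) (Pi.single j 1 - s)
  rw [dotProduct_sub, dotProduct_sub, h1, h2, dotProduct_single_one, dotProduct_single_one, h0]
    at h3
  linarith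

/-- If the residual given `K` is also uncorrelated with `X s`, then it is the residual given
`K ∪ {s}`. -/
theorem PartialUncorrelated.insert (hS : S.PosDef) {K : Finset V} {x : V → ℝ} {j s : V}
    (h : PartialUncorrelated S K x j) (hs : PartialUncorrelated S K x s) :
    PartialUncorrelated S (insert s K) x j := by
  obtain ⟨r, hr, h0⟩ := h
  obtain ⟨r', hr', h0'⟩ := hs
  obtain rfl := isRegression_unique hS hr hr'
  refine ⟨r, ⟨fun v hv => hr.1 v fun h => hv (Finset.mem_insert_of_mem h), fun k hk => ?_⟩, h0⟩
  rcases Finset.mem_insert.1 hk with rfl | hk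
  · exact h0'
  · exact hr.2 k hk

/-- The matrix with rows `i, K` and columns `j, K`, where `X j` has been replaced by its residual on
`X_K`, is block triangular. -/
theorem almostPrincipalMinor_eq_of_isRegression (hS : S.PosDef) {i j : V} {K : Finset V}
    {r : V → ℝ} (hr : IsRegression S K (Pi.single j 1) r) :
    almostPrincipalMinor S i j K =
      Matrix.vecMul (Pi.single j 1 - r) S i * principalMinor S K := by
  let f : V → Unit ⊕ K → V := fun v => Sum.elim (fun _ => v) (fun k => (k : V))
  let M : Matrix (Unit ⊕ K) (Unit ⊕ K) ℝ := S.submatrix (f i) (f j)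
  let D : Matrix K K ℝ := S.submatrix (fun k => (k : V)) (fun k => (k : V))
  let T : Matrix (Unit ⊕ K) (Unit ⊕ K) ℝ :=
    Matrix.fromBlocks 1 0 (Matrix.of fun (k : K) (_ : Unit) => -r k) 1
  have hcol : ∀ u : V, S u j + ∑ k : K, S u k * -r k = Matrix.vecMul (Pi.single j 1 - r) S u := by
    intro u
    have hsum : Matrix.vecMul r S u = ∑ k : K, S u k * r k := by
      rw [Finset.sum_coe_sort K (fun k => S u k * r k), Matrix.vecMul, dotProduct]
      rw [← Finset.sum_subset (Finset.subset_univ K) fun v _ hv => by simp [hr.1 v hv]]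
      exact Finset.sum_congr rfl fun v _ => by rw [(isSymm_of_posDef hS).apply u v, mul_comm]
    rw [Matrix.sub_vecMul, Pi.sub_apply, hsum, Matrix.single_one_vecMul, Matrix.row_apply,
      (isSymm_of_posDef hS).apply u j]
    simp [sub_eq_add_neg]
  have hMT : M * T = Matrix.fromBlocks
      (Matrix.of fun (_ _ : Unit) => Matrix.vecMul (Pi.single j 1 - r) S i)
      (Matrix.of fun (_ : Unit) (k : K) => S i k) 0 D := by
    ext (u | u) (k | k)
    · simpa [Matrix.mul_apply, M, T, f] using hcol i
    · simp [Matrix.mul_apply, M, T, f, Matrix.one_apply]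
    · simpa [Matrix.mul_apply, M, T, f, hr.2 u u.2] using hcol u
    · simp [Matrix.mul_apply, M, T, f, D, Matrix.one_apply]
  -- Right multiplication by `T` subtracts the columns of `K`, with weights `r`, from column `j`.
  have hT : T.det = 1 := by simp [T]
  have h : (M * T).det = M.det := by rw [Matrix.det_mul, hT, mul_one]
  rw [hMT, Matrix.det_fromBlocks_zero₂₁, Matrix.det_unique] at h
  exact h.symm

theorem omegaCond_eq_of_isRegression (hS : S.PosDef) {i : V} {A : Finset V} (hi : i ∉ A)
    {r : V → ℝ} (hr : IsRegression S A (Pi.single i 1) r) :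
    omegaCond S i A = Matrix.vecMul (Pi.single i 1 - r) S i := by
  rw [omegaCond, principalMinor_insert hi, almostPrincipalMinor_eq_of_isRegression hS hr,
    mul_div_cancel_right₀ _ (principalMinor_pos hS A).ne']

theorem lambdaCond_eq_of_isRegression (hS : S.PosDef) {i j : V} {A : Finset V} (hi : i ∈ A)
    {r : V → ℝ} (hr : IsRegression S A (Pi.single j 1) r) :
    lambdaCond S i j A = r i := by
  obtain ⟨s, hs⟩ := exists_isRegression hS (A.erase i) (Pi.single i 1)
  -- The regression of `X j` on `X_{A∖i}` is obtained by replacing `X i` in its regression on `X_A`.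
  have hreg : IsRegression S (A.erase i) (Pi.single j 1)
      (r - r i • Pi.single i 1 + r i • s) := by
    refine ⟨fun v hv => ?_, fun k hk => ?_⟩
    · by_cases hvi : v = i
      · subst hvi
        simp [hs.1 v hv]
      · have : v ∉ A := fun h => hv (Finset.mem_erase.2 ⟨hvi, h⟩)
        simp [hs.1 v hv, hr.1 v this, hvi]
    · have h1 := hr.2 k (Finset.mem_of_mem_erase hk)
      have h2 := hs.2 k hk
      have : (Pi.single j 1 - (r - r i • Pi.single i 1 + r i • s) : V → ℝ) =
          (Pi.single j 1 - r) + r i • (Pi.single i 1 - s) := by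
        module
      rw [this, Matrix.add_vecMul, Matrix.smul_vecMul, Pi.add_apply, Pi.smul_apply, h1, h2]
      simp
  have hval : Matrix.vecMul (Pi.single j 1 - (r - r i • Pi.single i 1 + r i • s)) S i =
      r i * Matrix.vecMul (Pi.single i 1 - s) S i := by
    have : (Pi.single j 1 - (r - r i • Pi.single i 1 + r i • s) : V → ℝ) =
        (Pi.single j 1 - r) + r i • (Pi.single i 1 - s) := by
      module
    rw [this, Matrix.add_vecMul, Matrix.smul_vecMul, Pi.add_apply, Pi.smul_apply, hr.2 i hi]
    simp
  have hA : principalMinor S A =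
      Matrix.vecMul (Pi.single i 1 - s) S i * principalMinor S (A.erase i) := by
    rw [← almostPrincipalMinor_eq_of_isRegression hS hs,
      ← principalMinor_insert (Finset.notMem_erase i A), Finset.insert_erase hi]
  have hpos := principalMinor_pos hS A
  rw [lambdaCond, almostPrincipalMinor_eq_of_isRegression hS hreg, hval, mul_assoc, ← hA,
    mul_div_cancel_right₀ _ hpos.ne']

end LinearAlgebra

/-! ### Structural equations -/

section Parametrization

variable {V : Type*} {G : Digraph V} {S : Matrix V V ℝ} {ω : V → ℝ} {Λ : Matrix V V ℝ}

theorem wellFounded_isDescendant [Finite V] (hG : IsAcyclic G) :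
    WellFounded (IsDescendant G) := by
  have : IsTrans V (IsDescendant G) := ⟨fun _ _ _ => Relation.TransGen.trans⟩
  have : Std.Irrefl (IsDescendant G) := ⟨hG⟩
  exact Finite.wellFounded_of_trans_of_irrefl _

/-- Nondescendants are closed under passing to ancestors. -/
theorem not_isDescendant_of_adj {i u v : V} (huv : G.Adj u v)
    (hv : ¬ IsDescendant G i v) : u ≠ i ∧ ¬ IsDescendant G i u :=
  ⟨fun h => hv (.single (h ▸ huv)), fun h => hv (h.tail huv)⟩

variable [Fintype V]

theorem mem_parents {i j : V} : i ∈ parents G j ↔ G.Adj i j := by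
  simp [parents]

theorem mem_nondescendants {i j : V} :
    j ∈ nondescendants G i ↔ j ≠ i ∧ ¬ IsDescendant G i j := by
  simp [nondescendants]

theorem parents_subset_nondescendants (hG : IsAcyclic G) (j : V) :
    parents G j ⊆ nondescendants G j := by
  intro i hi
  rw [mem_parents] at hi
  rw [mem_nondescendants]
  exact ⟨fun h => hG j (.single (h ▸ hi)), fun h => hG j (h.tail hi)⟩

theorem notMem_parents_self (hG : IsAcyclic G) (j : V) : j ∉ parents G j := fun h =>
  hG j (.single (mem_parents.1 h))

variable [DecidableEq V]

/-- A row vector fixed by `Λ` vanishes: its entry at `v` is a combination of the entries at the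
parents of `v`. -/
theorem isUnit_det_one_sub (hG : IsAcyclic G) (hΛ : ∀ i j, ¬ G.Adj i j → Λ i j = 0) :
    IsUnit (1 - Λ).det := by
  rw [← Matrix.isUnit_iff_isUnit_det, ← Matrix.vecMul_injective_iff_isUnit]
  refine (injective_iff_map_eq_zero ((1 - Λ).vecMulLinear)).2 fun x hx => ?_
  have hx' : x = Matrix.vecMul x Λ := by
    have : Matrix.vecMul x (1 - Λ) = 0 := hx
    rwa [Matrix.vecMul_sub, Matrix.vecMul_one, sub_eq_zero] at this
  ext v
  induction v using (wellFounded_isDescendant hG).induction with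
  | _ v ih =>
    rw [hx']
    refine Finset.sum_eq_zero fun u _ => ?_
    by_cases huv : G.Adj u v
    · simp [ih u (.single huv)]
    · simp [hΛ u v huv]

theorem eq_covParam_iff (hG : IsAcyclic G) (hΛ : ∀ i j, ¬ G.Adj i j → Λ i j = 0) :
    S = covParam ω Λ ↔ (1 - Λ).transpose * S * (1 - Λ) = Matrix.diagonal ω := by
  have hu := isUnit_det_one_sub hG hΛ
  have huT : IsUnit (1 - Λ).transpose.det := by rwa [Matrix.det_transpose]
  rw [covParam, Matrix.transpose_nonsing_inv]
  constructor
  · rintro rfl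
    simp only [Matrix.mul_assoc]
    rw [Matrix.nonsing_inv_mul _ hu, Matrix.mul_one, ← Matrix.mul_assoc,
      Matrix.mul_nonsing_inv _ huT, Matrix.one_mul]
  · intro h
    rw [← h]
    simp only [Matrix.mul_assoc]
    rw [Matrix.mul_nonsing_inv _ hu, Matrix.mul_one, ← Matrix.mul_assoc,
      Matrix.nonsing_inv_mul _ huT, Matrix.one_mul]

theorem posDef_covParam (hG : IsAcyclic G) (h : IsParameter G ω Λ) : (covParam ω Λ).PosDef := by
  have hu : IsUnit ((1 - Λ)⁻¹) := by
    rw [Matrix.isUnit_nonsing_inv_iff, Matrix.isUnit_iff_isUnit_det]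
    exact isUnit_det_one_sub hG h.2
  have hD : (Matrix.diagonal ω).PosDef := Matrix.PosDef.diagonal h.1
  have := hD.conjTranspose_mul_mul_same (B := (1 - Λ)⁻¹)
    (Matrix.mulVec_injective_of_isUnit hu)
  simpa [covParam, Matrix.conjTranspose_eq_transpose_of_trivial] using this

/-- The error term `X j - ∑ i, Λ i j * X i` of a structural equation, as a coefficient vector. -/
def errorVec (Λ : Matrix V V ℝ) (j : V) : V → ℝ := Pi.single j 1 - fun i => Λ i j

theorem one_sub_transpose_mul_apply (S Λ : Matrix V V ℝ) (j v : V) :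
    ((1 - Λ).transpose * S) j v = Matrix.vecMul (errorVec Λ j) S v := by
  simp only [Matrix.mul_apply, Matrix.vecMul, dotProduct, errorVec, Matrix.transpose_apply,
    Matrix.sub_apply, Pi.sub_apply, Matrix.one_apply, Pi.single_apply]

theorem one_sub_transpose_mul_mul_apply (S Λ : Matrix V V ℝ) (i j : V) :
    ((1 - Λ).transpose * S * (1 - Λ)) i j =
      Matrix.vecMul (errorVec Λ i) S ⬝ᵥ errorVec Λ j := by
  rw [Matrix.mul_apply, dotProduct]
  refine Finset.sum_congr rfl fun v _ => ?_
  rw [one_sub_transpose_mul_apply]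
  simp only [errorVec, Matrix.sub_apply, Pi.sub_apply, Matrix.one_apply, Pi.single_apply]

/-- In the DAG model, the error term of `X j` is uncorrelated with the nondescendants of `j`,
and its covariance with `X j` is its variance. -/
theorem vecMul_errorVec_covParam (hG : IsAcyclic G) (h : IsParameter G ω Λ) {j v : V}
    (hv : ¬ IsDescendant G j v) :
    Matrix.vecMul (errorVec Λ j) (covParam ω Λ) v = if v = j then ω j else 0 := by
  have hcov := (eq_covParam_iff (ω := ω) hG h.2).1 rfl
  induction v using (wellFounded_isDescendant hG).induction with
  | _ v ih =>
    have h1 : Matrix.vecMul (errorVec Λ j) (covParam ω Λ) ⬝ᵥ errorVec Λ v =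
        if v = j then ω j else 0 := by
      rw [← one_sub_transpose_mul_mul_apply, hcov, Matrix.diagonal_apply]
      simp only [eq_comm]
    have herr : errorVec Λ v = Pi.single v 1 - fun i => Λ i v := rfl
    rw [herr, dotProduct_sub, dotProduct_single_one] at h1
    have h2 : Matrix.vecMul (errorVec Λ j) (covParam ω Λ) ⬝ᵥ (fun i => Λ i v) = 0 := by
      refine Finset.sum_eq_zero fun u _ => ?_
      by_cases huv : G.Adj u v
      · have hu : ¬ IsDescendant G j u := fun hu => hv (hu.tail huv)
        have huj : u ≠ j := fun huj => hv (.single (huj ▸ huv))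
        simp [ih u (.single huv) hu, huj]
      · simp [h.2 u v huv]
    rw [← h1, h2, sub_zero]

theorem isRegression_parents_covParam (hG : IsAcyclic G) (h : IsParameter G ω Λ) (j : V) :
    IsRegression (covParam ω Λ) (parents G j) (Pi.single j 1) (fun i => Λ i j) := by
  refine ⟨fun v hv => h.2 v j fun hvj => hv (mem_parents.2 hvj), fun k hk => ?_⟩
  obtain ⟨hkj, hkd⟩ := mem_nondescendants.1 (parents_subset_nondescendants hG j hk)
  have := vecMul_errorVec_covParam hG h hkd
  rwa [if_neg hkj] at this

theorem isVertexIdentifying_parents (hG : IsAcyclic G) (j : V) :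
    IsVertexIdentifying G j (parents G j) := by
  intro ω Λ h
  rw [omegaCond_eq_of_isRegression (posDef_covParam hG h) (notMem_parents_self hG j)
    (isRegression_parents_covParam hG h j)]
  have := vecMul_errorVec_covParam hG h (hG j)
  rwa [if_pos rfl] at this

theorem isEdgeIdentifying_parents (hG : IsAcyclic G) (e : Edge G) :
    IsEdgeIdentifying G e (parents G e.1.2) := by
  intro ω Λ h
  exact lambdaCond_eq_of_isRegression (posDef_covParam hG h) (mem_parents.2 e.2)
    (isRegression_parents_covParam hG h e.1.2)

/-- If every error term is uncorrelated with the nondescendants, then the covariance matrix of the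
error terms is diagonal, as the earlier of two vertices is a nondescendant of the later one. -/
theorem eq_covParam_of_vecMul_errorVec (hG : IsAcyclic G) (hS : S.PosDef)
    (hΛ : ∀ i j, ¬ G.Adj i j → Λ i j = 0)
    (h : ∀ j v, v ≠ j → ¬ IsDescendant G j v → Matrix.vecMul (errorVec Λ j) S v = 0) :
    S = covParam (fun j => Matrix.vecMul (errorVec Λ j) S j) Λ := by
  rw [eq_covParam_iff hG hΛ]
  have key : ∀ i j, i ≠ j → ¬ IsDescendant G i j →
      Matrix.vecMul (errorVec Λ i) S ⬝ᵥ errorVec Λ j = 0 := by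
    intro i j hij hd
    refine Finset.sum_eq_zero fun v _ => ?_
    by_cases hvj : v = j
    · subst hvj
      simp [h i v hij.symm hd]
    by_cases hadj : G.Adj v j
    · obtain ⟨h1, h2⟩ := not_isDescendant_of_adj hadj hd
      simp [h i v h1 h2]
    · simp [errorVec, hvj, hΛ v j hadj]
  ext i j
  rw [one_sub_transpose_mul_mul_apply, Matrix.diagonal_apply]
  split_ifs with hij
  · subst hij
    have h0 : Matrix.vecMul (errorVec Λ i) S ⬝ᵥ (fun v => Λ v i) = 0 := by
      refine Finset.sum_eq_zero fun v _ => ?_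
      by_cases hadj : G.Adj v i
      · obtain ⟨h1, h2⟩ := mem_nondescendants.1
          (parents_subset_nondescendants hG i (mem_parents.2 hadj))
        simp [h i v h1 h2]
      · simp [hΛ v i hadj]
    have herr : errorVec Λ i = Pi.single i 1 - fun v => Λ v i := rfl
    nth_rw 2 [herr]
    rw [dotProduct_sub, h0, dotProduct_single_one, sub_zero]
  · by_cases hd : IsDescendant G i j
    · rw [vecMul_dotProduct_comm (isSymm_of_posDef hS)]
      exact key j i (Ne.symm hij) fun hd' => hG i (hd.trans hd')
    · exact key i j hij hd

/-- The local Markov property recovers the parametrization: regress every variable on its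
parents. -/
theorem eq_covParam_of_localMarkov (hG : IsAcyclic G) (hS : S.PosDef) (h : LocalMarkov G S) :
    ∃ ω Λ, IsParameter G ω Λ ∧ S = covParam ω Λ := by
  choose r hr using fun j : V => exists_isRegression hS (parents G j) (Pi.single j 1)
  let Λ : Matrix V V ℝ := Matrix.of fun i j => r j i
  have hvec : ∀ j, errorVec Λ j = Pi.single j 1 - r j := fun j => rfl
  have hΛ : ∀ i j, ¬ G.Adj i j → Λ i j = 0 := fun i j hij =>
    (hr j).1 i fun hi => hij (mem_parents.1 hi)
  have herr : ∀ j v, v ≠ j → ¬ IsDescendant G j v → Matrix.vecMul (errorVec Λ j) S v = 0 := by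
    intro j v hvj hd
    rw [hvec]
    by_cases hv : v ∈ parents G j
    · exact (hr j).2 v hv
    · obtain ⟨r', hr', h0⟩ := partialUncorrelated_of_gaussianCI hS (h j)
        (Finset.mem_singleton_self j)
        (Finset.mem_sdiff.2 ⟨mem_nondescendants.2 ⟨hvj, hd⟩, hv⟩)
      rwa [isRegression_unique hS (hr j) hr']
  refine ⟨_, Λ, ⟨fun j => ?_, hΛ⟩, eq_covParam_of_vecMul_errorVec hG hS hΛ herr⟩
  rw [hvec, ← omegaCond_eq_of_isRegression hS (notMem_parents_self hG j) (hr j)]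
  exact div_pos (principalMinor_pos hS _) (principalMinor_pos hS _)

end Parametrization

/-! ### Active paths -/

section Paths

variable {V : Type*} {G : Digraph V}

/-- A consecutive triple of `q ++ v :: t` lies in `q ++ [v]`, or in `v :: t`, or is centred
at `v`. -/
theorem triple_infix_append {a k b v : V} {q t : List V} (h : [a, k, b] <:+: q ++ v :: t) :
    [a, k, b] <:+: q ++ [v] ∨ [a, k, b] <:+: v :: t ∨
      (k = v ∧ (∃ q', q = q' ++ [a]) ∧ ∃ t', t = b :: t') := by
  induction q with
  | nil => exact Or.inr (Or.inl h)
  | cons c q ih =>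
    rw [List.cons_append, List.infix_cons_iff] at h
    rcases h with h | h
    · match q, h with
      | [], h =>
        obtain ⟨t', ht⟩ := h
        obtain ⟨rfl, rfl, rfl⟩ : a = c ∧ k = v ∧ b :: t' = t := by simpa using ht
        exact Or.inr (Or.inr ⟨rfl, ⟨[], rfl⟩, ⟨t', rfl⟩⟩)
      | [x], h =>
        obtain ⟨t', ht⟩ := h
        obtain ⟨rfl, rfl, rfl, -⟩ : a = c ∧ k = x ∧ b = v ∧ t' = t := by simpa using ht
        exact Or.inl List.infix_rfl
      | x :: y :: q, h =>
        obtain ⟨t', ht⟩ := h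
        obtain ⟨rfl, rfl, rfl, -⟩ : a = c ∧ k = x ∧ b = y ∧ t' = q ++ v :: t := by simpa using ht
        exact Or.inl ⟨[], q ++ [v], rfl⟩
    · rcases ih h with h | h | ⟨h1, ⟨q', h2⟩, h3⟩
      · exact Or.inl (List.infix_cons h)
      · exact Or.inr (Or.inl h)
      · exact Or.inr (Or.inr ⟨h1, ⟨c :: q', by rw [h2, List.cons_append]⟩, h3⟩)

theorem exists_triple_infix {i j k : V} {p : List V} (hi : p.head? = some i)
    (hj : p.getLast? = some j) (hk : k ∈ p) (hki : k ≠ i) (hkj : k ≠ j) :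
    ∃ a b, [a, k, b] <:+: p := by
  obtain ⟨q, t, rfl⟩ := List.append_of_mem hk
  rcases List.eq_nil_or_concat q with rfl | ⟨q, a, rfl⟩
  · exact absurd (by simpa using hi) hki
  match t, hj with
  | [], hj => exact absurd (by simpa using hj) hkj
  | b :: t, _ => exact ⟨a, b, q, t, by simp⟩

theorem IsColliderOn.mono {p q : List V} {k : V} (h : IsColliderOn G p k) (hpq : p <:+: q) :
    IsColliderOn G q k := by
  obtain ⟨a, b, hab, h1, h2⟩ := h
  exact ⟨a, b, hab.trans hpq, h1, h2⟩

/-- A path that starts with an outgoing edge of `v` is directed up to its end or up to its first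
collider, which is then a descendant of `v`. -/
theorem isDescendant_last_or_collider {v w j : V} {t : List V}
    (hp : (v :: w :: t).IsChain fun a b => G.Adj a b ∨ G.Adj b a) (hvw : G.Adj v w)
    (hj : (v :: w :: t).getLast? = some j) :
    IsDescendant G v j ∨ ∃ k, IsColliderOn G (v :: w :: t) k ∧ IsDescendant G v k := by
  induction t generalizing v w with
  | nil =>
    left
    have : w = j := by simpa using hj
    exact this ▸ .single hvw
  | cons b t ih =>
    by_cases hbw : G.Adj b w
    · exact Or.inr ⟨w, ⟨v, b, ⟨[], t, rfl⟩, hvw, hbw⟩, .single hvw⟩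
    · have hp' := (List.isChain_cons_cons.1 hp).2
      have hwb : G.Adj w b := ((List.isChain_cons_cons.1 hp').1).resolve_right hbw
      rcases ih hp' hwb (by simpa using hj) with h | ⟨k, hk, hwk⟩
      · exact Or.inl (.head hvw h)
      · exact Or.inr ⟨k, hk.mono (List.suffix_cons _ _).isInfix, .head hvw hwk⟩

/-- `k` belongs to `K` or has a descendant in `K`. -/
def ReachesSet (G : Digraph V) (K : Finset V) (k : V) : Prop :=
  ∃ d ∈ K, Relation.ReflTransGen G.Adj k d

theorem ReachesSet.of_isDescendant {K : Finset V} {v k : V} (h : ReachesSet G K k)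
    (hvk : IsDescendant G v k) : ∃ d ∈ K, IsDescendant G v d := by
  obtain ⟨d, hd, hkd⟩ := h
  exact ⟨d, hd, hvk.trans_left hkd⟩

/-- The consecutive vertices `a, k, b` do not block a path given `K`. -/
def ActiveAt (G : Digraph V) (K : Finset V) (a k b : V) : Prop :=
  (G.Adj a k ∧ G.Adj b k → ReachesSet G K k) ∧ (¬ (G.Adj a k ∧ G.Adj b k) → k ∉ K)

theorem ActiveAt.symm {K : Finset V} {a k b : V} (h : ActiveAt G K a k b) :
    ActiveAt G K b k a :=
  ⟨fun h' => h.1 h'.symm, fun h' => h.2 fun h'' => h' h''.symm⟩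

/-- `p` is a path from `i` to `j` none of whose inner vertices blocks it given `K`. -/
structure IsActivePath (G : Digraph V) (K : Finset V) (i j : V) (p : List V) : Prop where
  isPath : IsPath G p
  head : p.head? = some i
  last : p.getLast? = some j
  active : ∀ a k b, [a, k, b] <:+: p → ActiveAt G K a k b

theorem IsActivePath.reverse {K : Finset V} {i j : V} {p : List V} (h : IsActivePath G K i j p) :
    IsActivePath G K j i p.reverse := by
  refine ⟨⟨List.nodup_reverse.2 h.isPath.1, List.isChain_reverse.2 ?_⟩, ?_, ?_, ?_⟩
  · exact h.isPath.2.imp fun a b hab => hab.symm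
  · rw [List.head?_reverse, h.last]
  · rw [List.getLast?_reverse, h.head]
  · intro a k b hab
    refine (h.active b k a ?_).symm
    rw [← List.reverse_infix]
    exact hab

theorem IsActivePath.suffix {K : Finset V} {i j s : V} {q t : List V}
    (h : IsActivePath G K i j (q ++ s :: t)) : IsActivePath G K s j (s :: t) := by
  refine ⟨⟨h.isPath.1.of_append_right, h.isPath.2.right_of_append⟩, rfl, ?_, fun a k b hab =>
    h.active a k b (hab.trans (List.suffix_append _ _).isInfix)⟩
  simpa using h.last

/-- Prolonging an active path backwards along an edge `p → s`. -/
theorem IsActivePath.cons (hG : IsAcyclic G) {K : Finset V} {u j s : V} {p : List V}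
    (h : IsActivePath G K u j p) (hus : G.Adj u s) (hu : u ∉ K) (hs : s ∉ p) :
    IsActivePath G K s j (s :: p) := by
  obtain ⟨t, rfl⟩ : ∃ t, p = u :: t := by
    have := h.head
    cases p with
    | nil => simp at this
    | cons x t => exact ⟨t, by simpa using this⟩
  refine ⟨⟨List.nodup_cons.2 ⟨hs, h.isPath.1⟩, List.isChain_cons_cons.2 ⟨Or.inr hus, h.isPath.2⟩⟩,
    rfl, by simpa using h.last, fun a k b hab => ?_⟩
  rcases List.infix_cons_iff.1 hab with hab | hab
  · obtain ⟨t', ht⟩ := hab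
    obtain ⟨rfl, rfl, rfl⟩ : a = s ∧ k = u ∧ b :: t' = t := by simpa using ht
    exact ⟨fun h' => absurd (.tail (.single hus) h'.1) (hG k), fun _ => hu⟩
  · exact h.active a k b hab

/-- An active path that leaves `s` along an outgoing edge leads to a descendant of `s` which is its
end or a member of the conditioning set. -/
theorem IsActivePath.exists_isDescendant {K : Finset V} {v w j : V} {t : List V}
    (h : IsActivePath G K v j (v :: w :: t)) (hvw : G.Adj v w) :
    IsDescendant G v j ∨ ∃ d ∈ K, IsDescendant G v d := by
  rcases isDescendant_last_or_collider h.isPath.2 hvw h.last with h' | ⟨k, ⟨a, b, hab, h1, h2⟩, hk⟩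
  · exact Or.inl h'
  · exact Or.inr (((h.active a k b hab).1 ⟨h1, h2⟩).of_isDescendant hk)

/-- A vertex `s` without descendants in `K ∪ {i, j}` is a collider on every active path from `i` to
`j` that passes through it. -/
theorem IsActivePath.collider_of_sink {K : Finset V} {i j a s b : V} {p : List V}
    (h : IsActivePath G K i j p) (hi : ¬ IsDescendant G s i) (hj : ¬ IsDescendant G s j)
    (hK : ∀ d ∈ K, ¬ IsDescendant G s d) (hab : [a, s, b] <:+: p) : G.Adj a s ∧ G.Adj b s := by
  have key : ∀ {i j a b : V} {p : List V}, IsActivePath G K i j p → ¬ IsDescendant G s j →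
      [a, s, b] <:+: p → G.Adj b s := by
    intro i j a b p h hj hab
    obtain ⟨q, t, rfl⟩ := hab
    have h' : IsActivePath G K s j (s :: b :: t) := by
      refine IsActivePath.suffix (i := i) (q := q ++ [a]) ?_
      simpa using h
    refine ((List.isChain_cons_cons.1 h'.isPath.2).1).resolve_left fun hsb => ?_
    rcases h'.exists_isDescendant hsb with h1 | ⟨d, hd, h1⟩
    · exact hj h1
    · exact hK d hd h1
  have hba : [b, s, a] <:+: p.reverse := by
    rw [← List.reverse_infix] at hab
    exact hab
  exact ⟨key h.reverse hi hba, key h hj hab⟩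

theorem exists_first_mem {p q : List V} (h : ∃ x ∈ p, x ∈ q) :
    ∃ p₁ v p₂, p = p₁ ++ v :: p₂ ∧ v ∈ q ∧ ∀ x ∈ p₁, x ∉ q := by
  induction p with
  | nil => simp at h
  | cons c p ih =>
    by_cases hc : c ∈ q
    · exact ⟨[], c, p, rfl, hc, by simp⟩
    · obtain ⟨x, hx, hxq⟩ := h
      have hxp : x ∈ p := (List.mem_cons.1 hx).resolve_left fun e => hc (e ▸ hxq)
      obtain ⟨p₁, v, p₂, rfl, hv, hp₁⟩ := ih ⟨x, hxp, hxq⟩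
      exact ⟨c :: p₁, v, p₂, rfl, hv, by simpa [hc] using hp₁⟩

theorem isChain_append_cons {R : V → V → Prop} {q t : List V} {v : V}
    (h1 : (q ++ [v]).IsChain R) (h2 : (v :: t).IsChain R) : (q ++ v :: t).IsChain R := by
  induction q with
  | nil => exact h2
  | cons c q ih =>
    cases q with
    | nil => exact List.isChain_cons_cons.2 ⟨(List.isChain_cons_cons.1 h1).1, h2⟩
    | cons d q =>
      obtain ⟨h3, h4⟩ := List.isChain_cons_cons.1 h1
      exact List.isChain_cons_cons.2 ⟨h3, ih h4⟩

/-- Two active paths given `K`, from `i` to `s` and from `s` to `j`, combine to an active path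
given `K ∪ {s}` if `s` is a sink as far as `K ∪ {i, j}` is concerned. The path switches from the
first to the second at the first common vertex. If this vertex is a collider on the new path but on
neither of the old ones, then the first path leaves it along an outgoing edge, and so leads to a
descendant in `K ∪ {s}`. -/
theorem IsActivePath.join [DecidableEq V] {K : Finset V} {i j s : V} {p₁ p₂ : List V}
    (hp₁ : IsActivePath G K i s p₁) (hp₂ : IsActivePath G K s j p₂)
    (hs : ¬ IsDescendant G s s) (hi : ¬ IsDescendant G s i) (hj : ¬ IsDescendant G s j)
    (hK : ∀ d ∈ K, ¬ IsDescendant G s d) :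
    ∃ p, IsActivePath G (insert s K) i j p := by
  have hsp₂ : s ∈ p₂ := List.mem_of_mem_head? hp₂.head
  obtain ⟨q₁, v, t₁, rfl, hv₂, hq₁⟩ :=
    exists_first_mem (q := p₂) ⟨s, List.mem_of_getLast? hp₁.last, hsp₂⟩
  obtain ⟨q₂, t₂, rfl⟩ := List.append_of_mem hv₂
  have hpre : (q₁ ++ [v]) <:+: q₁ ++ v :: t₁ := ⟨[], t₁, by simp⟩
  have hsuf : (v :: t₂) <:+: q₂ ++ v :: t₂ := (List.suffix_append _ _).isInfix
  have hmono : ∀ {k}, ReachesSet G K k → ReachesSet G (insert s K) k := fun ⟨d, hd, hkd⟩ =>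
    ⟨d, Finset.mem_insert_of_mem hd, hkd⟩
  have hlift : ∀ {i' j' a k b : V} {p : List V}, IsActivePath G K i' j' p →
      ¬ IsDescendant G s i' → ¬ IsDescendant G s j' → [a, k, b] <:+: p →
      ActiveAt G (insert s K) a k b := by
    intro i' j' a k b p hp hi' hj' hab
    refine ⟨fun hc => hmono ((hp.active a k b hab).1 hc), fun hc hk => ?_⟩
    rcases Finset.mem_insert.1 hk with rfl | hk
    · exact hc (hp.collider_of_sink hi' hj' hK hab)
    · exact (hp.active a k b hab).2 hc hk
  refine ⟨q₁ ++ v :: t₂, ⟨?_, ?_⟩, ?_, ?_, fun a k b hab => ?_⟩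
  · refine List.Nodup.append hp₁.isPath.1.of_append_left hp₂.isPath.1.of_append_right
      fun x hx hx' => hq₁ x hx (List.mem_append_right _ hx')
  · have h1 := hp₁.isPath.2.infix hpre
    have h2 := hp₂.isPath.2.infix hsuf
    exact isChain_append_cons h1 h2
  · have := hp₁.head
    cases q₁ <;> simpa using this
  · have := hp₂.last
    simpa using this
  rcases triple_infix_append hab with hab | hab | ⟨rfl, ⟨q₁', rfl⟩, t₂', rfl⟩
  · exact hlift hp₁ hi hs (hab.trans hpre)
  · exact hlift hp₂ hs hj (hab.trans hsuf)
  -- The only new triple is the one centred at the vertex `k` where the two paths meet.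
  have h₁ : IsActivePath G K k s (k :: t₁) := hp₁.suffix
  have h₂ : IsActivePath G K k j (k :: b :: t₂') := hp₂.suffix
  by_cases hks : k = s
  · subst hks
    have h₁' : IsActivePath G K k i (k :: a :: q₁'.reverse) := by
      refine IsActivePath.suffix (i := k) (q := t₁.reverse) ?_
      simpa using hp₁.reverse
    have hout : ∀ {l c : V} {t : List V}, IsActivePath G K k l (k :: c :: t) →
        ¬ IsDescendant G k l → G.Adj c k := fun h hl =>
      ((List.isChain_cons_cons.1 h.isPath.2).1).resolve_left fun hkc =>
        (h.exists_isDescendant hkc).elim hl fun ⟨d, hd, hkd⟩ => hK d hd hkd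
    exact ⟨fun _ => ⟨k, Finset.mem_insert_self k K, .refl⟩,
      fun hc => absurd ⟨hout h₁' hi, hout h₂ hj⟩ hc⟩
  · obtain ⟨c, t₁', rfl⟩ : ∃ c t₁', t₁ = c :: t₁' := by
      cases t₁ with
      | nil => exact absurd (by simpa using h₁.last) hks
      | cons c t₁' => exact ⟨c, t₁', rfl⟩
    obtain ⟨q₂', d, rfl⟩ : ∃ q₂' d, q₂ = q₂' ++ [d] := by
      rcases List.eq_nil_or_concat q₂ with rfl | ⟨q₂', d, h⟩
      · exact absurd (by simpa using hp₂.head) hks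
      · exact ⟨q₂', d, by simpa using h⟩
    have hac := hp₁.active a k c ⟨q₁', t₁', by simp⟩
    have hdb := hp₂.active d k b ⟨q₂', t₂', by simp⟩
    refine ⟨fun hc => ?_, fun hc hk => ?_⟩
    · by_cases hck : G.Adj c k
      · exact hmono (hac.1 ⟨hc.1, hck⟩)
      · have hkc : G.Adj k c := ((List.isChain_cons_cons.1 h₁.isPath.2).1).resolve_right hck
        rcases h₁.exists_isDescendant hkc with h | ⟨e, he, h⟩
        · exact ⟨s, Finset.mem_insert_self s K, h.to_reflTransGen⟩
        · exact ⟨e, Finset.mem_insert_of_mem he, h.to_reflTransGen⟩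
    · have hkK : k ∈ K := (Finset.mem_insert.1 hk).resolve_left hks
      refine hc ⟨?_, ?_⟩
      · by_contra h
        exact hac.2 (fun h' => h h'.1) hkK
      · by_contra h
        exact hdb.2 (fun h' => h h'.2) hkK

/-- d-separated sets are not joined by active paths. -/
theorem not_isActivePath_of_dSeparated {I J K : Finset V} (h : DSeparated G I J K) {i j : V}
    (hi : i ∈ I) (hj : j ∈ J) (p : List V) : ¬ IsActivePath G K i j p := by
  intro hp
  obtain ⟨k, hk, h'⟩ := h.2 p hp.isPath ⟨i, hi, hp.head⟩ ⟨j, hj, hp.last⟩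
  rcases h' with ⟨hc, hkK⟩ | ⟨⟨a, b, hab, h1, h2⟩, hkK, hd⟩
  · have hki : k ≠ i := fun e => Finset.disjoint_left.1 h.1.2.1 hi (e ▸ hkK)
    have hkj : k ≠ j := fun e => Finset.disjoint_left.1 h.1.2.2 hj (e ▸ hkK)
    obtain ⟨a, b, hab⟩ := exists_triple_infix hp.head hp.last hk hki hkj
    exact (hp.active a k b hab).2 (fun h'' => hc ⟨a, b, hab, h''⟩) hkK
  · obtain ⟨d, hdK, hkd⟩ := (hp.active a k b hab).1 ⟨h1, h2⟩
    rcases Relation.reflTransGen_iff_eq_or_transGen.1 hkd with rfl | hkd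
    · exact hkK hdK
    · exact hd d hkd hdK

/-- A vertex is d-separated by its parents from its other nondescendants. -/
theorem dSeparated_parents [Fintype V] [DecidableEq V] (hG : IsAcyclic G) (i : V) :
    DSeparated G {i} (nondescendants G i \ parents G i) (parents G i) := by
  refine ⟨⟨?_, ?_, Finset.sdiff_disjoint⟩, ?_⟩
  · rw [Finset.disjoint_singleton_left, Finset.mem_sdiff, mem_nondescendants]
    exact fun h => h.1.1 rfl
  · exact Finset.disjoint_singleton_left.2 (notMem_parents_self hG i)
  rintro p hp ⟨i', hi', hhead⟩ ⟨j, hj, hlast⟩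
  obtain rfl := Finset.mem_singleton.1 hi'
  obtain ⟨hjn, hjp⟩ := Finset.mem_sdiff.1 hj
  obtain ⟨hji, hjd⟩ := mem_nondescendants.1 hjn
  match p, hhead with
  | [x], hhead =>
    obtain rfl : x = i' := by simpa using hhead
    exact absurd (by simpa using hlast) hji.symm
  | x :: w :: t, hhead =>
    obtain rfl : x = i' := by simpa using hhead
    rcases (List.isChain_cons_cons.1 hp.2).1 with hxw | hwx
    · rcases isDescendant_last_or_collider hp.2 hxw hlast with h | ⟨k, hk, hxk⟩
      · exact absurd h hjd
      · have hk' := hk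
        obtain ⟨a, b, hab, -⟩ := hk'
        refine ⟨k, hab.subset (by simp), Or.inr ⟨hk, fun h => ?_, fun d hkd h => ?_⟩⟩
        · exact hG x (hxk.tail (mem_parents.1 h))
        · exact hG x ((hxk.trans hkd).tail (mem_parents.1 h))
    · refine ⟨w, by simp, Or.inl ⟨?_, mem_parents.2 hwx⟩⟩
      rintro ⟨a, b, hab, haw, -⟩
      have hnd := hp.1
      rcases List.infix_cons_iff.1 hab with hab | hab
      · obtain ⟨rfl, -⟩ := List.cons_prefix_cons.1 hab
        exact hG w (.tail (.single hwx) haw)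
      · have hw : w ∈ t := by
          rcases List.infix_cons_iff.1 hab with hab | hab
          · obtain ⟨rfl, hab⟩ := List.cons_prefix_cons.1 hab
            exact hab.subset (by simp)
          · exact hab.subset (by simp)
        exact (List.nodup_cons.1 (List.nodup_cons.1 hnd).2).1 hw

end Paths

/-! ### Separation in the DAG model -/

section Separation

variable {V : Type*} [Fintype V] [DecidableEq V] {G : Digraph V}
  {ω : V → ℝ} {Λ : Matrix V V ℝ}

theorem exists_sink {V : Type*} [Finite V] {G : Digraph V} (hG : IsAcyclic G) {A : Finset V}
    (hA : A.Nonempty) :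
    ∃ s ∈ A, ∀ d ∈ A, ¬ IsDescendant G s d := by
  have : IsTrans V (Function.swap (IsDescendant G)) := ⟨fun _ _ _ h1 h2 => h2.trans h1⟩
  have : Std.Irrefl (Function.swap (IsDescendant G)) := ⟨hG⟩
  obtain ⟨s, hs, h⟩ := (Finite.wellFounded_of_trans_of_irrefl
    (Function.swap (IsDescendant G))).has_min (A : Set V) hA
  exact ⟨s, hs, fun d hd => h d hd⟩

/-- Separation for single vertices, by induction on an ancestral set `A` containing all vertices
involved. A sink `s` of `A` is removed; if `s` is one of the two vertices, it is replaced by its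
parents through its structural equation, and if it is in the conditioning set, it is separated
given the other conditioning variables from at least one of the two vertices. -/
theorem partialUncorrelated_covParam (hG : IsAcyclic G) (h : IsParameter G ω Λ) (A : Finset V) :
    (∀ u v, G.Adj u v → v ∈ A → u ∈ A) → ∀ K ⊆ A, ∀ i ∈ A, ∀ j ∈ A, i ∉ K → j ∉ K →
      (∀ p, ¬ IsActivePath G K i j p) →
      PartialUncorrelated (covParam ω Λ) K (Pi.single i 1) j := by
  induction A using Finset.strongInduction with
  | H A ih =>
  intro hA K hKA i hiA j hjA hiK hjK hp
  have hS := posDef_covParam hG h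
  obtain ⟨s, hsA, hs⟩ := exists_sink hG ⟨i, hiA⟩
  have hA' : ∀ u v, G.Adj u v → v ∈ A.erase s → u ∈ A.erase s := fun u v huv hv =>
    Finset.mem_erase.2 ⟨fun e => hs v (Finset.mem_of_mem_erase hv) (.single (e ▸ huv)),
      hA u v huv (Finset.mem_of_mem_erase hv)⟩
  have ih' := ih (A.erase s) (Finset.erase_ssubset hsA) hA'
  have hsub : ∀ {K}, K ⊆ A → s ∉ K → K ⊆ A.erase s := fun hK hsK v hv =>
    Finset.mem_erase.2 ⟨fun e => hsK (e ▸ hv), hK hv⟩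
  have hsink : ∀ K ⊆ A, s ∉ K → ∀ j ∈ A, j ∉ K → (∀ p, ¬ IsActivePath G K s j p) →
      PartialUncorrelated (covParam ω Λ) K (Pi.single s 1) j := by
    intro K hKA hsK j hjA hjK hp
    have hjs : j ≠ s := by
      rintro rfl
      exact hp [j] ⟨⟨by simp, by simp⟩, rfl, rfl, fun a k b hab => by
        have := hab.length_le; simp at this⟩
    have heq : (Pi.single s 1 : V → ℝ) =
        errorVec Λ s + ∑ u, Λ u s • (Pi.single u 1 : V → ℝ) := by
      ext v
      simp [errorVec, Finset.sum_apply, Pi.single_apply]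
    rw [heq]
    refine PartialUncorrelated.add ⟨0, ⟨fun _ _ => rfl, fun k hk => ?_⟩, ?_⟩
      (PartialUncorrelated.sum _ fun u _ => ?_)
    · rw [sub_zero, vecMul_errorVec_covParam hG h (hs k (hKA hk)),
        if_neg fun e => hsK (by rwa [← e])]
    · rw [sub_zero, vecMul_errorVec_covParam hG h (hs j hjA), if_neg hjs]
    by_cases hus : G.Adj u s
    · refine PartialUncorrelated.smul ?_ _
      by_cases huK : u ∈ K
      · exact partialUncorrelated_single_of_mem huK j
      · have huA : u ∈ A.erase s := Finset.mem_erase.2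
          ⟨fun e => hG s (.single (e ▸ hus)), hA u s hus hsA⟩
        refine ih' K (hsub hKA hsK) u huA j (Finset.mem_erase.2 ⟨hjs, hjA⟩) huK hjK fun p h' => ?_
        by_cases hsp : s ∈ p
        · obtain ⟨q, t, rfl⟩ := List.append_of_mem hsp
          exact hp _ h'.suffix
        · exact hp _ (h'.cons hG hus huK hsp)
    · rw [h.2 u s hus, zero_smul]
      exact PartialUncorrelated.zero K j
  by_cases hsi : i = s
  · subst hsi
    exact hsink K hKA hiK j hjA hjK hp
  by_cases hsj : j = s
  · subst hsj
    exact (hsink K hKA hjK i hiA hiK fun p h' => hp _ h'.reverse).symm hS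
  have hi' : i ∈ A.erase s := Finset.mem_erase.2 ⟨hsi, hiA⟩
  have hj' : j ∈ A.erase s := Finset.mem_erase.2 ⟨hsj, hjA⟩
  by_cases hsK : s ∈ K
  · have hins : insert s (K.erase s) = K := Finset.insert_erase hsK
    have hK'A : K.erase s ⊆ A := (Finset.erase_subset s K).trans hKA
    have hsK' : s ∉ K.erase s := Finset.notMem_erase s K
    have hiK' : i ∉ K.erase s := fun h' => hiK (Finset.mem_of_mem_erase h')
    have hjK' : j ∉ K.erase s := fun h' => hjK (Finset.mem_of_mem_erase h')
    have hsdK : ∀ d ∈ K.erase s, ¬ IsDescendant G s d := fun d hd => hs d (hK'A hd)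
    have hij : PartialUncorrelated (covParam ω Λ) (K.erase s) (Pi.single i 1) j := by
      refine ih' _ (hsub hK'A hsK') i hi' j hj' hiK' hjK' fun p h' =>
        hp p ⟨h'.isPath, h'.head, h'.last, fun a k b hab => ⟨fun hc => ?_, fun hc hk => ?_⟩⟩
      · obtain ⟨d, hd, hkd⟩ := (h'.active a k b hab).1 hc
        exact ⟨d, Finset.mem_of_mem_erase hd, hkd⟩
      · by_cases hks : k = s
        · subst hks
          exact hc (h'.collider_of_sink (hs i hiA) (hs j hjA) hsdK hab)
        · exact (h'.active a k b hab).2 hc (Finset.mem_erase.2 ⟨hks, hk⟩)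
    by_cases hsj' : ∃ p₂, IsActivePath G (K.erase s) s j p₂
    · obtain ⟨p₂, hp₂⟩ := hsj'
      have his : ∀ p, ¬ IsActivePath G (K.erase s) s i p := fun p₁ hp₁ => by
        obtain ⟨p, hp'⟩ := hp₁.reverse.join hp₂ (hs s hsA) (hs i hiA) (hs j hjA) hsdK
        rw [hins] at hp'
        exact hp p hp'
      have := hij.insert hS ((hsink _ hK'A hsK' i hiA hiK' his).symm hS)
      rwa [hins] at this
    · have := (hij.symm hS).insert hS
        ((hsink _ hK'A hsK' j hjA hjK' (not_exists.1 hsj')).symm hS)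
      rw [hins] at this
      exact this.symm hS
  · exact ih' K (hsub hKA hsK) i hi' j hj' hiK hjK hp

theorem globalMarkov_covParam (hG : IsAcyclic G) (h : IsParameter G ω Λ) :
    GlobalMarkov G (covParam ω Λ) := fun _ _ K hd =>
  gaussianCI_of_partialUncorrelated (posDef_covParam hG h) fun i hi j hj =>
    partialUncorrelated_covParam hG h Finset.univ (fun _ _ _ _ => Finset.mem_univ _) K
      (Finset.subset_univ K) i (Finset.mem_univ i) j (Finset.mem_univ j)
      (Finset.disjoint_left.1 hd.1.2.1 hi) (Finset.disjoint_left.1 hd.1.2.2 hj)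
      (not_isActivePath_of_dSeparated hd hi hj)

theorem GlobalMarkov.localMarkov (hG : IsAcyclic G) {S : Matrix V V ℝ} (h : GlobalMarkov G S) :
    LocalMarkov G S := fun i => h _ _ _ (dSeparated_parents hG i)

end Separation
end GaussianDAG

/-! ### Equivalence of the model and the Markov properties -/

theorem mainTheorem5 {V C : Type*} [Fintype V] [DecidableEq V] [Finite C]
    (D : ColoredDAG V C) (S : Matrix V V ℝ) (hS : S.PosDef) :
    List.TFAE [S ∈ D.model, D.LocalColoredMarkov S, D.GlobalColoredMarkov S] := by
  have hG := D.acyclic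
  tfae_have 1 → 3 := by
    rintro ⟨-, ω, Λ, ⟨h, hv, he⟩, rfl⟩
    refine ⟨globalMarkov_covParam hG h, fun i j hij A B hA hB => ?_, fun e f hef A B hA hB => ?_⟩
    · rw [ColoredDAG.VCC, hA ω Λ h, hB ω Λ h, hv i j hij, sub_self]
    · rw [ColoredDAG.ECC, hA ω Λ h, hB ω Λ h, he e f hef, sub_self]
  tfae_have 3 → 2 := fun ⟨hM, hv, he⟩ =>
    ⟨hM.localMarkov hG,
      fun i j hij => hv i j hij _ _ (isVertexIdentifying_parents hG i)
        (isVertexIdentifying_parents hG j),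
      fun e f hef => he e f hef _ _ (isEdgeIdentifying_parents hG e)
        (isEdgeIdentifying_parents hG f)⟩
  tfae_have 2 → 1 := by
    rintro ⟨hM, hv, he⟩
    obtain ⟨ω, Λ, h, rfl⟩ := eq_covParam_of_localMarkov hG hS hM
    refine ⟨hS, ω, Λ, ⟨h, fun i j hij => ?_, fun e f hef => ?_⟩, rfl⟩
    · rw [← isVertexIdentifying_parents hG i ω Λ h, ← isVertexIdentifying_parents hG j ω Λ h]
      exact sub_eq_zero.1 (hv i j hij)
    · rw [← isEdgeIdentifying_parents hG e ω Λ h, ← isEdgeIdentifying_parents hG f ω Λ h]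
      exact sub_eq_zero.1 (he e f hef)
  tfae_finish
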